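/- Let $\mathcal H$ be a real Hilbert space. Let $f:\mathcal H\to\mathbb R$ be convex and of class $C^1$ with $L$-Lipschitz continuous gradient, let $g:\mathcal H\to\mathbb R\cup\{+\infty\}$ be proper, convex and lower semicontinuous, put $\theta:=f+g$, and suppose that $S:=\operatorname{argmin}_{\mathcal H}\theta\neq\emptyset$. For $s>0$ let $\operatorname{prox}_{sg}(v)$ be the unique minimizer of $x\mapsto s\,g(x)+\frac12\|x-v\|^2$, and let $$T_s(y)=\frac1s\Big(y-\operatorname{prox}_{sg}\big(y-s\nabla f(y)\big)\Big).$$ Let $\alpha\ge 3$ and $sL\in\,]0,1]$, and fix $j\in\{0,1\}$. Let $(y_k)_{k\ge0}$ and $(w_k)_{k\ge0}$ be generated by the Ravine accelerated proximal gradient method from arbitrary initial points $y_0,y_1\in\mathcal H$, i.e. $$w_k=y_k-sT_s(y_k)\quad(k\ge0),\qquad y_{k+1}=w_k+\Big(1-\frac{\alpha}{k+j}\Big)(w_k-w_{k-1})\quad(k\ge1).$$ Then $\theta(w_k)<+\infty$ for all $k$, and $$\theta(w_k)-\min_{\mathcal H}\theta=\mathcal O\Big(\frac1{k^2}\Big)\quad\text{as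 }k\to+\infty.$$ If moreover $\alpha>3$, then $$\theta(w_k)-\min_{\mathcal H}\theta=o\Big(\frac1{k^2}\Big)\quad\text{as }k\to+\infty,$$ and there is $z\in S$ such that both $(y_k)$ and $(w_k)$ converge weakly to $z$. -/

import Mathlib

open Filter Topology Asymptotics
open scoped NNReal

namespace RAPG

variable {H : Type*} [NormedAddCommGroup H] [InnerProductSpace ℝ H]

/-- `g : H → ℝ ∪ {+∞}` is proper: it never takes the value `-∞` (so that it is a function into
`ℝ ∪ {+∞}`), and it is not identically `+∞`. -/
def Proper (g : H → EReal) : Prop :=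
  (∀ x, g x ≠ ⊥) ∧ ∃ x, g x ≠ ⊤

/-- Convexity of an extended-real-valued function that never takes the value `-∞`
(in `EReal`, `0 * ⊤ = 0`, so the cases `a = 0` and `b = 0` are trivially true). -/
def EConvex (g : H → EReal) : Prop :=
  ∀ x y : H, ∀ a b : ℝ, 0 ≤ a → 0 ≤ b → a + b = 1 →
    g (a • x + b • y) ≤ (a : EReal) * g x + (b : EReal) * g y

/-- The composite objective `θ = f + g`. -/
noncomputable def theta (f : H → ℝ) (g : H → EReal) (x : H) : EReal :=
  (f x : EReal) + g x

/-- The set of global minimizers of `θ` over `H`. -/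
def argmin (θ : H → EReal) : Set H :=
  {z | ∀ x, θ z ≤ θ x}

/-- The proximal point of `h` at `v`: the minimizer over `x` of `h x + ‖x - v‖² / 2`. The
minimizer exists and is unique when `h` is proper, convex and lower semicontinuous on a Hilbert
space; an arbitrary point is returned when there is no minimizer. -/
noncomputable def prox (h : H → EReal) (v : H) : H :=
  Classical.epsilon fun p => p ∈ argmin fun x => h x + ((‖x - v‖ ^ 2 / 2 : ℝ) : EReal)

/-- The operator `T_s(y) = (1/s) (y - prox_{s g} (y - s ∇f(y)))`. -/
noncomputable def T [CompleteSpace H] (f : H → ℝ) (g : H → EReal) (s : ℝ) (y : H) : H :=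
  (1 / s) • (y - prox (fun x => (s : EReal) * g x) (y - s • gradient f y))

/-- `(y k)` and `(w k)` are generated by the Ravine accelerated proximal gradient method with
parameter `α`, step size `s` and index offset `j`, from arbitrary initial points `y 0`, `y 1`:
`w_k = y_k - s T_s(y_k)` for `k ≥ 0` and
`y_{k+1} = w_k + (1 - α / (k + j)) (w_k - w_{k-1})` for `k ≥ 1`. -/
structure IsRAPG [CompleteSpace H] (f : H → ℝ) (g : H → EReal) (s α : ℝ) (j : ℕ)
    (y w : ℕ → H) : Prop where
  w_eq : ∀ k : ℕ, w k = y k - s • T f g s (y k)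
  y_succ : ∀ k : ℕ, 1 ≤ k →
    y (k + 1) = w k + (1 - α / ((k : ℝ) + (j : ℝ))) • (w k - w (k - 1))

/-- Convergence of a sequence for the weak topology of `H`. -/
def WeakLim (u : ℕ → H) (z : H) : Prop :=
  Tendsto (fun k => toWeakSpace ℝ H (u k)) atTop (𝓝 (toWeakSpace ℝ H z))

end RAPG

/-!
Everything takes place on the effective domain `D` of `g`, where `g` is a real convex function with
closed sublevel sets. A minimizer of `θ = f + g` exists, so by Fermat's rule
(`add_inner_neg_gradient_le_of_minimizer`) `g` has a continuous affine minorant; hence proximal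
points exist (`exists_prox`) and every `w k` is the result of a genuine proximal gradient step.
For `s L ≤ 1` such a step `p` from `y` satisfies, for all `x ∈ D`,

  `θ p + ‖p - x‖² / (2 s) ≤ θ x + ‖y - x‖² / (2 s)`        (`proximal_gradient_inequality`),

and only this inequality is used afterwards. Let `z` be a minimizer and `W n = θ (w n) - θ z`.

* At `x = (1 - τ) w (n + 1) + τ z` with `τ = (α - 1) / (n + 1 + j)`, it shows that
  `(n + j)² W (n + 1) + ‖(α - 1) (w n - z) + (n + j) (w (n + 1) - w n)‖² / (2 s)` is eventually
  nonincreasing for `α ≥ 3`, with decrease at least `((α - 3) (n + 1 + j) + 1) W (n + 1)`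
  (`energy_succ_le`). This gives the rate `O(1 / k²)` and, for `α > 3`, the summability of
  `n W (n + 1)`.
* At `x = w (n + 1)`, it shows that the mechanical energy
  `(n + j)² (W (n + 1) + ‖w (n + 1) - w n‖² / (2 s))` decreases up to an error of order
  `n W (n + 1)` (`mechanicalEnergy_succ_le`). For `α > 3` the error is summable, the mechanical
  energy converges, and its quotient by `n` is summable, so that it tends to `0`. This gives the
  rate `o(1 / k²)` and `n ‖w (n + 1) - w n‖ → 0`.
* Consequently the convergence of the first energy becomes that of `‖w n - z‖`, for every
  minimizer `z`, and Opial's lemma (`opial`) yields the weak limit of `w`. The points `y n` have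
  the same weak limit because `y n - w n → 0` in norm.

Only the inequalities for large `n` matter, so neither the initial points nor the sign of
`1 - α / (k + j)` for small `k` plays any role.
-/

namespace RAPG

variable {H : Type*} [NormedAddCommGroup H] [InnerProductSpace ℝ H]

/-! ### Real sequences -/

/-- Quasi-Fejér monotonicity: a nonnegative sequence that decreases by `r n` up to a summable error
`ε n` converges, and `r` is summable. -/
theorem summable_and_tendsto_of_le_add {E r ε : ℕ → ℝ} (N : ℕ)
    (hE : ∀ n ≥ N, 0 ≤ E n) (hr : ∀ n ≥ N, 0 ≤ r n) (hε : ∀ n ≥ N, 0 ≤ ε n)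
    (hsum : Summable ε) (hstep : ∀ n ≥ N, E (n + 1) + r n ≤ E n + ε n) :
    Summable r ∧ ∃ l, Tendsto E atTop (𝓝 l) := by
  have hsum' : Summable fun n => ε (n + N) := (summable_nat_add_iff N).2 hsum
  have hle : ∀ n, ∑ i ∈ Finset.range n, ε (i + N) ≤ ∑' i, ε (i + N) := fun n =>
    hsum'.sum_le_tsum _ fun i _ => hε _ (by omega)
  have hkey : ∀ n, E (n + N) + ∑ i ∈ Finset.range n, r (i + N)
      ≤ E N + ∑ i ∈ Finset.range n, ε (i + N) := by
    intro n
    induction n with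
    | zero => simp
    | succ n ih =>
      rw [Finset.sum_range_succ, Finset.sum_range_succ]
      have h := hstep (n + N) (by omega)
      rw [show n + 1 + N = n + N + 1 by omega]
      linarith
  constructor
  · refine (summable_nat_add_iff N).1 <|
      summable_of_sum_range_le (c := E N + ∑' i, ε (i + N)) (fun n => hr _ (by omega)) fun n => ?_
    have h1 := hkey n
    have h2 := hE (n + N) (by omega)
    have h3 := hle n
    linarith
  · set F : ℕ → ℝ := fun n => E (n + N) - ∑ i ∈ Finset.range n, ε (i + N) with hF
    have hanti : Antitone F := by
      refine antitone_nat_of_succ_le fun n => ?_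
      have h := hstep (n + N) (by omega)
      have h' := hr (n + N) (by omega)
      simp only [hF, Finset.sum_range_succ]
      rw [show n + 1 + N = n + N + 1 by omega]
      linarith
    have hbdd : BddBelow (Set.range F) := by
      refine ⟨-∑' i, ε (i + N), ?_⟩
      rintro _ ⟨n, rfl⟩
      have h2 := hE (n + N) (by omega)
      have h3 := hle n
      simp only [hF]
      linarith
    refine ⟨_, (tendsto_add_atTop_iff_nat N).1
      (((tendsto_atTop_ciInf hanti hbdd).add hsum'.hasSum.tendsto_sum_nat).congr fun n => ?_)⟩
    simp [hF]

/-- If `A n / n` is dominated by a summable sequence, then the only possible limit of `A` is `0`,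
because the harmonic series diverges. -/
theorem limit_eq_zero_of_summable {A r : ℕ → ℝ} {b l : ℝ} (hb : 0 ≤ b) (hA : ∀ n, 0 ≤ A n)
    (hl : Tendsto A atTop (𝓝 l)) (hr : Summable r) (hle : ∀ᶠ n in atTop, A n ≤ (n + b) * r n) :
    l = 0 := by
  by_contra hne
  have hpos : 0 < l := lt_of_le_of_ne (ge_of_tendsto' hl hA) (Ne.symm hne)
  have hev : ∀ᶠ n in atTop, l / 2 < A n := hl.eventually (lt_mem_nhds (by linarith))
  refine Real.not_summable_one_div_natCast ?_
  refine Summable.of_norm_bounded_eventually_nat (hr.mul_left ((1 + b) * (2 / l))) ?_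
  filter_upwards [hev, hle, eventually_ge_atTop 1] with n h1 h2 hn
  have hn' : (1 : ℝ) ≤ n := by exact_mod_cast hn
  have hrn : 0 < r n := by
    by_contra hcon
    nlinarith [mul_nonneg (by linarith : (0 : ℝ) ≤ n + b) (by linarith : (0 : ℝ) ≤ -r n)]
  have h3 : (n + b) * r n ≤ (1 + b) * n * r n := by
    refine mul_le_mul_of_nonneg_right ?_ hrn.le
    nlinarith
  rw [Real.norm_of_nonneg (by positivity), div_le_iff₀ (by linarith)]
  have h4 : l / 2 ≤ (1 + b) * n * r n := by linarith
  calc (1 : ℝ) = 2 / l * (l / 2) := by field_simp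
    _ ≤ 2 / l * ((1 + b) * n * r n) := by gcongr
    _ = _ := by ring

/-- First-order optimality in one variable: divide by `t` and let `t` tend to `0`. -/
theorem nonneg_of_forall_add_sq {a b : ℝ} (h : ∀ t : ℝ, 0 < t → t ≤ 1 → 0 ≤ t * a + t ^ 2 * b) :
    0 ≤ a := by
  have hlim : Tendsto (fun t : ℝ => a + t * b) (𝓝[>] 0) (𝓝 a) := by
    have : Continuous fun t : ℝ => a + t * b := by fun_prop
    simpa using (this.tendsto 0).mono_left nhdsWithin_le_nhds
  refine ge_of_tendsto hlim ?_
  filter_upwards [Ioc_mem_nhdsGT (zero_lt_one' ℝ)] with t ht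
  have := h t ht.1 ht.2
  rw [show t * a + t ^ 2 * b = t * (a + t * b) by ring] at this
  exact nonneg_of_mul_nonneg_right this ht.1

/-! ### Smooth convex functions -/

section Smooth
variable [CompleteSpace H] {f : H → ℝ} {f' : H → H} {L : ℝ≥0}

/-- The descent lemma: a function with `L`-Lipschitz gradient lies below its quadratic upper
model. -/
theorem le_add_inner_add_sq (hf : ∀ x, HasGradientAt f (f' x) x) (hL : LipschitzWith L f')
    (x d : H) : f (x + d) ≤ f x + inner ℝ (f' x) d + L / 2 * ‖d‖ ^ 2 := by
  set φ : ℝ → ℝ := fun t => f (x + t • d) - t * inner ℝ (f' x) d - L / 2 * t ^ 2 * ‖d‖ ^ 2 with hφ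
  have hd : ∀ t, HasDerivAt φ
      (inner ℝ (f' (x + t • d)) d - inner ℝ (f' x) d - L * t * ‖d‖ ^ 2) t := by
    intro t
    have h1 : HasDerivAt (fun t : ℝ => x + t • d) d t := by
      simpa using ((hasDerivAt_id t).smul_const d).const_add x
    have h2 : HasDerivAt (fun t : ℝ => f (x + t • d)) (inner ℝ (f' (x + t • d)) d) t := by
      have h := (hf (x + t • d)).hasFDerivAt.comp_hasDerivAt t h1
      rwa [InnerProductSpace.toDual_apply_apply] at h
    have h3 : HasDerivAt (fun t : ℝ => t * inner ℝ (f' x) d) (inner ℝ (f' x) d) t := by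
      simpa using (hasDerivAt_id t).mul_const (inner ℝ (f' x) d)
    have h4 : HasDerivAt (fun t : ℝ => (L : ℝ) / 2 * t ^ 2 * ‖d‖ ^ 2) (L * t * ‖d‖ ^ 2) t := by
      refine (((hasDerivAt_pow 2 t).const_mul ((L : ℝ) / 2)).mul_const (‖d‖ ^ 2)).congr_deriv ?_
      push_cast
      ring
    exact (h2.sub h3).sub h4
  have hanti : AntitoneOn φ (Set.Icc 0 1) := by
    refine antitoneOn_of_deriv_nonpos (convex_Icc 0 1)
      (fun t _ => (hd t).continuousAt.continuousWithinAt)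
      (fun t _ => (hd t).differentiableAt.differentiableWithinAt) fun t ht => ?_
    rw [interior_Icc] at ht
    rw [(hd t).deriv, ← inner_sub_left]
    have h1 := real_inner_le_norm (f' (x + t • d) - f' x) d
    have h2 : ‖f' (x + t • d) - f' x‖ ≤ L * (t * ‖d‖) := by
      have := hL.norm_sub_le (x + t • d) x
      rwa [add_sub_cancel_left, norm_smul, Real.norm_of_nonneg ht.1.le] at this
    have h3 := mul_le_mul_of_nonneg_right h2 (norm_nonneg d)
    nlinarith
  have := hanti (Set.left_mem_Icc.2 zero_le_one) (Set.right_mem_Icc.2 zero_le_one) zero_le_one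
  simp only [hφ, one_smul, zero_smul, add_zero] at this
  linarith

/-- The lower quadratic model, which is the descent lemma for `-f`. -/
theorem add_inner_sub_sq_le (hf : ∀ x, HasGradientAt f (f' x) x) (hL : LipschitzWith L f')
    (x d : H) : f x + inner ℝ (f' x) d - L / 2 * ‖d‖ ^ 2 ≤ f (x + d) := by
  have hneg : ∀ x, HasGradientAt (fun x => -f x) (-f' x) x := fun x => by
    have := (hf x).hasFDerivAt.neg
    rw [hasGradientAt_iff_hasFDerivAt, map_neg]
    exact this
  have := le_add_inner_add_sq hneg hL.neg x d
  simp only [inner_neg_left] at this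
  linarith

/-- A smooth convex function lies above its tangent hyperplanes. -/
theorem gradient_inequality (hf : ∀ x, HasGradientAt f (f' x) x) (hL : LipschitzWith L f')
    (hc : ConvexOn ℝ Set.univ f) (x y : H) : f x + inner ℝ (f' x) (y - x) ≤ f y := by
  have key : 0 ≤ f y - f x - inner ℝ (f' x) (y - x) := by
    refine nonneg_of_forall_add_sq (b := L / 2 * ‖y - x‖ ^ 2) fun t ht0 ht1 => ?_
    have h1 := add_inner_sub_sq_le hf hL x (t • (y - x))
    have h2 := hc.2 (Set.mem_univ x) (Set.mem_univ y) (sub_nonneg.2 ht1) ht0.le (by ring)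
    rw [show (1 - t) • x + t • y = x + t • (y - x) by module] at h2
    rw [norm_smul, mul_pow, Real.norm_of_nonneg ht0.le, real_inner_smul_right] at h1
    simp only [smul_eq_mul] at h2
    nlinarith
  linarith

/-- Fermat's rule: at a minimizer `z` of `f + G`, the vector `-∇f z` is a subgradient of `G`. This
provides `G` with a continuous affine minorant, hence with proximal points. -/
theorem add_inner_neg_gradient_le_of_minimizer (hf : ∀ x, HasGradientAt f (f' x) x)
    (hL : LipschitzWith L f') {D : Set H} {G : H → ℝ} (hG : ConvexOn ℝ D G) {z : H} (hz : z ∈ D)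
    (hmin : ∀ x ∈ D, f z + G z ≤ f x + G x) {x : H} (hx : x ∈ D) :
    G z + inner ℝ (-f' z) (x - z) ≤ G x := by
  have key : 0 ≤ G x - G z + inner ℝ (f' z) (x - z) := by
    refine nonneg_of_forall_add_sq (b := L / 2 * ‖x - z‖ ^ 2) fun t ht0 ht1 => ?_
    have h1 := le_add_inner_add_sq hf hL z (t • (x - z))
    have h2 := hG.2 hz hx (sub_nonneg.2 ht1) ht0.le (by ring)
    have h3 := hmin _ (hG.1 hz hx (sub_nonneg.2 ht1) ht0.le (by ring))
    rw [show (1 - t) • z + t • x = z + t • (x - z) by module] at h2 h3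
    rw [norm_smul, mul_pow, Real.norm_of_nonneg ht0.le, real_inner_smul_right] at h1
    simp only [smul_eq_mul] at h2
    nlinarith
  rw [inner_neg_left]
  linarith

end Smooth

/-! ### Proximal points -/

/-- The sum of a lower semicontinuous function (encoded by its closed sublevel sets in its domain
`D`) and a continuous function is lower semicontinuous. -/
theorem isClosed_sublevel_add {X : Type*} [PseudoMetricSpace X] {D : Set X} {G h : X → ℝ}
    (hcl : ∀ c, IsClosed {x | x ∈ D ∧ G x ≤ c}) (hh : Continuous h) (c : ℝ) :
    IsClosed {x | x ∈ D ∧ G x + h x ≤ c} := by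
  refine IsSeqClosed.isClosed fun u x hu hx => ?_
  have hlim : Tendsto (fun n => c - h (u n)) atTop (𝓝 (c - h x)) :=
    ((hh.tendsto x).comp hx).const_sub c
  have hsub : ∀ ε > 0, x ∈ D ∧ G x ≤ c - h x + ε := fun ε hε => by
    refine (hcl _).mem_of_tendsto hx ?_
    filter_upwards [hlim.eventually (gt_mem_nhds (lt_add_of_pos_right _ hε))] with n hn
    exact ⟨(hu n).1, by linarith [(hu n).2]⟩
  refine ⟨(hsub 1 one_pos).1, ?_⟩
  have := le_of_forall_pos_le_add fun ε hε => (hsub ε hε).2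
  linarith

section Prox
variable {D : Set H} {G : H → ℝ}

/-- The minimum of `G + ‖· - v‖² / 2` is attained: by the parallelogram law every minimizing
sequence is Cauchy. -/
theorem exists_prox [CompleteSpace H] (hG : ConvexOn ℝ D G)
    (hcl : ∀ c, IsClosed {x | x ∈ D ∧ G x ≤ c}) (hne : D.Nonempty) {a : H} {b : ℝ}
    (hminor : ∀ x ∈ D, b + inner ℝ a x ≤ G x) (v : H) :
    ∃ p ∈ D, ∀ x ∈ D, G p + ‖p - v‖ ^ 2 / 2 ≤ G x + ‖x - v‖ ^ 2 / 2 := by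
  set F : H → ℝ := fun x => G x + ‖x - v‖ ^ 2 / 2 with hF
  have hbdd : BddBelow (F '' D) := by
    -- Completing the square in the affine minorant.
    refine ⟨b + inner ℝ a v - ‖a‖ ^ 2 / 2, ?_⟩
    rintro _ ⟨x, hx, rfl⟩
    have h1 := hminor x hx
    have h2 : 0 ≤ ‖a + (x - v)‖ ^ 2 := by positivity
    rw [norm_add_sq_real, inner_sub_right] at h2
    simp only [hF]
    linarith
  set m := sInf (F '' D) with hm
  have hmle : ∀ x ∈ D, m ≤ F x := fun x hx => csInf_le hbdd ⟨x, hx, rfl⟩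
  have hex : ∀ n : ℕ, ∃ x ∈ D, F x < m + 1 / ((n : ℝ) + 1) := fun n => by
    obtain ⟨_, ⟨x, hx, rfl⟩, h⟩ :=
      exists_lt_of_csInf_lt (hne.image F) (lt_add_of_pos_right m (Nat.one_div_pos_of_nat (n := n)))
    exact ⟨x, hx, h⟩
  choose u huD hu using hex
  -- Strong convexity: the values at `x`, `x'` and their midpoint control `‖x - x'‖`.
  have hmid : ∀ x ∈ D, ∀ x' ∈ D, ‖x - x'‖ ^ 2 ≤ 4 * ((F x - m) + (F x' - m)) := by
    intro x hx x' hx'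
    have h1 := hG.2 hx hx' (by norm_num : (0 : ℝ) ≤ 1 / 2) (by norm_num : (0 : ℝ) ≤ 1 / 2)
      (by norm_num)
    have h2 := hmle _ (hG.1 hx hx' (by norm_num : (0 : ℝ) ≤ 1 / 2)
      (by norm_num : (0 : ℝ) ≤ 1 / 2) (by norm_num))
    have h3 := parallelogram_law_with_norm ℝ (x - v) (x' - v)
    rw [show x - v - (x' - v) = x - x' by abel] at h3
    have h4 : ‖((1 / 2 : ℝ) • x + (1 / 2 : ℝ) • x') - v‖ = 1 / 2 * ‖x - v + (x' - v)‖ := by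
      rw [show ((1 / 2 : ℝ) • x + (1 / 2 : ℝ) • x') - v = (1 / 2 : ℝ) • (x - v + (x' - v)) by
        module, norm_smul]
      norm_num
    simp only [hF, h4, smul_eq_mul] at *
    nlinarith
  have hlim0 : Tendsto (fun n : ℕ => 1 / ((n : ℝ) + 1)) atTop (𝓝 0) :=
    tendsto_one_div_add_atTop_nhds_zero_nat
  have hcau : CauchySeq u := by
    refine cauchySeq_of_le_tendsto_0 (fun n : ℕ => Real.sqrt (8 * (1 / ((n : ℝ) + 1)))) ?_ ?_
    · intro n k N hn hk
      rw [dist_eq_norm]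
      refine Real.le_sqrt_of_sq_le ?_
      have h1 := hmid _ (huD n) _ (huD k)
      have h2 := hu n
      have h3 := hu k
      have h4 := Nat.one_div_le_one_div (α := ℝ) hn
      have h5 := Nat.one_div_le_one_div (α := ℝ) hk
      linarith
    · simpa using (hlim0.const_mul 8).sqrt
  obtain ⟨p, hp⟩ := cauchySeq_tendsto_of_complete hcau
  have hsub : ∀ ε > 0, p ∈ D ∧ F p ≤ m + ε := by
    intro ε hε
    refine (isClosed_sublevel_add hcl (h := fun x => ‖x - v‖ ^ 2 / 2) (by fun_prop)
      (m + ε)).mem_of_tendsto hp ?_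
    filter_upwards [hlim0.eventually (gt_mem_nhds hε)] with n hn
    exact ⟨huD n, (hu n).le.trans (by linarith)⟩
  exact ⟨p, (hsub 1 one_pos).1, fun x hx =>
    (le_of_forall_pos_le_add fun ε hε => (hsub ε hε).2).trans (hmle x hx)⟩

/-- At a proximal point `p` of `v`, the vector `v - p` is a subgradient of `G`. -/
theorem add_inner_le_of_isProx (hG : ConvexOn ℝ D G) {p v : H} (hp : p ∈ D)
    (hmin : ∀ x ∈ D, G p + ‖p - v‖ ^ 2 / 2 ≤ G x + ‖x - v‖ ^ 2 / 2) {x : H} (hx : x ∈ D) :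
    G p + inner ℝ (v - p) (x - p) ≤ G x := by
  have key : 0 ≤ G x - G p - inner ℝ (v - p) (x - p) := by
    refine nonneg_of_forall_add_sq (b := ‖x - p‖ ^ 2 / 2) fun t ht0 ht1 => ?_
    have h2 := hG.2 hp hx (sub_nonneg.2 ht1) ht0.le (by ring)
    have h3 := hmin _ (hG.1 hp hx (sub_nonneg.2 ht1) ht0.le (by ring))
    have h4 : ‖(1 - t) • p + t • x - v‖ ^ 2
        = ‖p - v‖ ^ 2 - 2 * (t * inner ℝ (v - p) (x - p)) + t ^ 2 * ‖x - p‖ ^ 2 := by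
      rw [show (1 - t) • p + t • x - v = -(v - p) + t • (x - p) by module, norm_add_sq_real,
        norm_neg, norm_sub_rev v p, inner_neg_left, real_inner_smul_right, norm_smul, mul_pow,
        Real.norm_of_nonneg ht0.le]
      ring
    simp only [smul_eq_mul] at h2
    nlinarith
  linarith

/-- The three-point inequality for one proximal gradient step `p` from `y`. The convergence analysis
uses nothing else about the step. -/
theorem proximal_gradient_inequality [CompleteSpace H] {f : H → ℝ} {f' : H → H} {L : ℝ≥0} {s : ℝ}
    (hf : ∀ x, HasGradientAt f (f' x) x) (hL : LipschitzWith L f')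
    (hc : ConvexOn ℝ Set.univ f) (hs : 0 < s) (hsL : s * L ≤ 1) (hG : ConvexOn ℝ D G) {y p : H}
    (hp : p ∈ D) (hmin : ∀ x ∈ D, s * G p + ‖p - (y - s • f' y)‖ ^ 2 / 2
      ≤ s * G x + ‖x - (y - s • f' y)‖ ^ 2 / 2) {x : H} (hx : x ∈ D) :
    f p + G p + 1 / (2 * s) * ‖p - x‖ ^ 2 ≤ f x + G x + 1 / (2 * s) * ‖y - x‖ ^ 2 := by
  have h1 := add_inner_le_of_isProx (hG.smul hs.le) hp hmin hx
  have h2 := gradient_inequality hf hL hc y x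
  have h3 := le_add_inner_add_sq hf hL y (p - y)
  rw [add_sub_cancel] at h3
  have h4 : L / 2 * ‖p - y‖ ^ 2 * s ≤ 1 / 2 * ‖p - y‖ ^ 2 := by
    nlinarith [sq_nonneg ‖p - y‖]
  have h5 : ‖y - x‖ ^ 2 = ‖p - y‖ ^ 2 - 2 * inner ℝ (y - p) (x - p) + ‖p - x‖ ^ 2 := by
    rw [show y - x = (y - p) - (x - p) by abel, norm_sub_sq_real, norm_sub_rev y p,
      norm_sub_rev x p]
  have h6 : (inner ℝ (y - s • f' y - p) (x - p) : ℝ)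
      = inner ℝ (y - p) (x - p) - s * (inner ℝ (f' y) (x - y) - inner ℝ (f' y) (p - y)) := by
    rw [← inner_sub_right, show x - y - (p - y) = x - p by abel,
      show y - s • f' y - p = (y - p) - s • f' y by abel, inner_sub_left, real_inner_smul_left]
  have h1' : s * G p + inner ℝ (y - s • f' y - p) (x - p) ≤ s * G x := h1
  rw [h6] at h1'
  have key : s * (f p + G p) + 1 / 2 * ‖p - x‖ ^ 2 ≤ s * (f x + G x) + 1 / 2 * ‖y - x‖ ^ 2 := by
    have h2' := mul_le_mul_of_nonneg_left h2 hs.le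
    have h3' := mul_le_mul_of_nonneg_left h3 hs.le
    rw [h5]
    nlinarith
  refine le_of_mul_le_mul_left ?_ hs
  have e : ∀ a b : ℝ, s * (a + 1 / (2 * s) * b) = s * a + 1 / 2 * b := fun a b => by field_simp
  rw [e, e]
  exact key

end Prox

/-! ### Weak convergence -/

theorem weakLim_iff_forall_inner [CompleteSpace H] {u : ℕ → H} {z : H} :
    WeakLim u z ↔ ∀ v, Tendsto (fun k => inner ℝ v (u k)) atTop (𝓝 (inner ℝ v z)) := by
  unfold WeakLim
  have hinj : Function.Injective (topDualPairing ℝ H).flip := by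
    intro x x' h
    refine ext_inner_left ℝ fun v => ?_
    exact DFunLike.congr_fun h (InnerProductSpace.toDual ℝ H v)
  refine (WeakBilin.tendsto_iff_forall_eval_tendsto (topDualPairing ℝ H).flip hinj).trans ?_
  constructor
  · intro h v
    exact h (InnerProductSpace.toDual ℝ H v)
  · intro h φ
    obtain ⟨v, rfl⟩ := (InnerProductSpace.toDual ℝ H).surjective φ
    exact h v

/-- Weak compactness of balls in a Hilbert space, along ultrafilters: Banach–Alaoglu transported
through the Riesz isomorphism. -/
theorem exists_weak_limit_of_bounded [CompleteSpace H] {u : ℕ → H} {R : ℝ} (hR : ∀ n, ‖u n‖ ≤ R)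
    (U : Ultrafilter ℕ) : ∃ z, ∀ v, Tendsto (fun n => inner ℝ v (u n)) U (𝓝 (inner ℝ v z)) := by
  let F : ℕ → WeakDual ℝ H := fun n => StrongDual.toWeakDual (InnerProductSpace.toDual ℝ H (u n))
  have hK := WeakDual.isCompact_closedBall (𝕜 := ℝ) (E := H) 0 R
  have hmem : ((U.map F : Ultrafilter (WeakDual ℝ H)) : Filter (WeakDual ℝ H)) ≤
      𝓟 (WeakDual.toStrongDual ⁻¹' Metric.closedBall (0 : StrongDual ℝ H) R) := by
    rw [le_principal_iff, Ultrafilter.coe_map, Filter.mem_map]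
    refine Filter.univ_mem' fun n => ?_
    change InnerProductSpace.toDual ℝ H (u n) ∈ Metric.closedBall (0 : StrongDual ℝ H) R
    simpa using hR n
  obtain ⟨φ, -, hφ⟩ := hK.ultrafilter_le_nhds _ hmem
  refine ⟨(InnerProductSpace.toDual ℝ H).symm (WeakDual.toStrongDual φ), fun v => ?_⟩
  have h := ((WeakDual.eval_continuous v).tendsto φ).comp (show Tendsto F U (𝓝 φ) from hφ)
  rw [real_inner_comm, InnerProductSpace.toDual_symm_apply]
  refine h.congr fun n => ?_
  change InnerProductSpace.toDual ℝ H (u n) v = _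
  rw [InnerProductSpace.toDual_apply_apply, real_inner_comm]

/-- Opial's lemma. Cluster points are tested along ultrafilters, so that no weakly convergent
subsequence has to be extracted. -/
theorem opial [CompleteSpace H] {u : ℕ → H} {S : Set H} (hS : S.Nonempty)
    (hdist : ∀ z ∈ S, ∃ l, Tendsto (fun n => ‖u n - z‖) atTop (𝓝 l))
    (hclus : ∀ U : Ultrafilter ℕ, (U : Filter ℕ) ≤ atTop → ∀ z,
      (∀ v, Tendsto (fun n => inner ℝ v (u n)) U (𝓝 (inner ℝ v z))) → z ∈ S) :
    ∃ z ∈ S, WeakLim u z := by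
  obtain ⟨z₀, hz₀⟩ := hS
  obtain ⟨l₀, hl₀⟩ := hdist z₀ hz₀
  obtain ⟨R, hR⟩ := hl₀.bddAbove_range
  have hbd : ∀ n, ‖u n‖ ≤ R + ‖z₀‖ := fun n => by
    have h1 : ‖u n - z₀‖ ≤ R := hR ⟨n, rfl⟩
    have h2 := norm_add_le (u n - z₀) z₀
    rw [sub_add_cancel] at h2
    linarith
  -- `⟪z - z', u n⟫` is an affine function of the two convergent squared distances.
  have huniq : ∀ z ∈ S, ∀ z' ∈ S, ∃ c, Tendsto (fun n => inner ℝ (z - z') (u n)) atTop (𝓝 c) := by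
    intro z hz z' hz'
    obtain ⟨l, hl⟩ := hdist z hz
    obtain ⟨l', hl'⟩ := hdist z' hz'
    refine ⟨_, (((hl'.pow 2).sub (hl.pow 2)).add_const (‖z‖ ^ 2 - ‖z'‖ ^ 2)
      |>.div_const 2).congr fun n => ?_⟩
    rw [norm_sub_sq_real, norm_sub_sq_real, inner_sub_left, real_inner_comm z, real_inner_comm z']
    ring
  obtain ⟨z, hz⟩ := exists_weak_limit_of_bounded hbd (Ultrafilter.of (atTop : Filter ℕ))
  have hzS := hclus _ (Ultrafilter.of_le _) z hz
  refine ⟨z, hzS, weakLim_iff_forall_inner.2 fun v => ?_⟩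
  rw [tendsto_iff_ultrafilter]
  intro U hU
  obtain ⟨z', hz'⟩ := exists_weak_limit_of_bounded hbd U
  obtain ⟨c, hc⟩ := huniq z hzS z' (hclus U hU z' hz')
  have e1 := tendsto_nhds_unique (hz (z - z')) (hc.mono_left (Ultrafilter.of_le _))
  have e2 := tendsto_nhds_unique (hz' (z - z')) (hc.mono_left hU)
  have e3 : z = z' := by
    rw [← sub_eq_zero, ← inner_self_eq_zero (𝕜 := ℝ), inner_sub_right, e1, e2, sub_self]
  rw [e3]
  exact hz' v

/-- Closed convex sets are weakly closed. -/
theorem mem_of_weak_limit [CompleteSpace H] {C : Set H} (hC : Convex ℝ C) (hcl : IsClosed C)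
    {l : Filter ℕ} [l.NeBot] {u : ℕ → H} {z : H} (hu : ∀ᶠ n in l, u n ∈ C)
    (hz : ∀ v, Tendsto (fun n => inner ℝ v (u n)) l (𝓝 (inner ℝ v z))) : z ∈ C := by
  by_contra hzC
  obtain ⟨φ, c, h1, h2⟩ := geometric_hahn_banach_closed_point hC hcl hzC
  obtain ⟨v, rfl⟩ := (InnerProductSpace.toDual ℝ H).surjective φ
  simp only [InnerProductSpace.toDual_apply_apply] at h1 h2
  exact absurd (le_of_tendsto (hz v) (hu.mono fun n hn => (h1 _ hn).le)) (not_le.2 h2)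

theorem WeakLim.of_norm_sub_tendsto [CompleteSpace H] {u v : ℕ → H} {z : H} (hu : WeakLim u z)
    (huv : Tendsto (fun n => ‖v n - u n‖) atTop (𝓝 0)) : WeakLim v z := by
  rw [weakLim_iff_forall_inner] at *
  intro a
  have h0 : Tendsto (fun n => v n - u n) atTop (𝓝 0) := tendsto_zero_iff_norm_tendsto_zero.2 huv
  have h1 : Tendsto (fun n => inner ℝ a (v n - u n)) atTop (𝓝 (inner ℝ a 0)) :=
    tendsto_const_nhds.inner h0
  simpa [inner_sub_right] using h1.add (hu a)

/-! ### Lyapunov analysis of the inertial scheme -/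

section Lyapunov
variable {D : Set H} {Θ : H → ℝ} {c α j : ℝ} {w : ℕ → H} {z : H}

/-- `w` satisfies, for an objective `Θ` that is convex on its domain `D`, the three-point inequality
of a proximal step with `c = 1 / (2 * step size)` from the extrapolated point
`w (n + 1) + (1 - α / (n + 1 + j)) • (w (n + 1) - w n)`. The points where the steps start are
eliminated. -/
structure IsInertialDescent (D : Set H) (Θ : H → ℝ) (c α j : ℝ) (w : ℕ → H) : Prop where
  convexOn : ConvexOn ℝ D Θ
  mem : ∀ n, w n ∈ D
  step : ∀ n : ℕ, ∀ x ∈ D, Θ (w (n + 2)) + c * ‖w (n + 2) - x‖ ^ 2 ≤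
    Θ x + c * ‖w (n + 1) + (1 - α / (n + 1 + j)) • (w (n + 1) - w n) - x‖ ^ 2

/-- The Lyapunov function of the accelerated method with respect to `z`, multiplied by `(α - 1) ^ 2`
to clear the denominators in the usual momentum parameters `t n = (n + j) / (α - 1)`. -/
def energy (Θ : H → ℝ) (c α j : ℝ) (w : ℕ → H) (z : H) (n : ℕ) : ℝ :=
  (n + j) ^ 2 * (Θ (w (n + 1)) - Θ z)
    + c * ‖(α - 1) • (w n - z) + (n + j) • (w (n + 1) - w n)‖ ^ 2

/-- Potential plus kinetic energy of the iteration, with weight `(n + j) ^ 2`. -/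
def mechanicalEnergy (Θ : H → ℝ) (c j : ℝ) (w : ℕ → H) (z : H) (n : ℕ) : ℝ :=
  (n + j) ^ 2 * (Θ (w (n + 1)) - Θ z + c * ‖w (n + 1) - w n‖ ^ 2)

namespace IsInertialDescent

theorem energy_nonneg (h : IsInertialDescent D Θ c α j w) (hc : 0 ≤ c)
    (hmin : ∀ x ∈ D, Θ z ≤ Θ x) (n : ℕ) : 0 ≤ energy Θ c α j w z n := by
  have := sub_nonneg.2 (hmin _ (h.mem (n + 1)))
  unfold energy
  positivity

theorem mechanicalEnergy_nonneg (h : IsInertialDescent D Θ c α j w) (hc : 0 ≤ c)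
    (hmin : ∀ x ∈ D, Θ z ≤ Θ x) (n : ℕ) : 0 ≤ mechanicalEnergy Θ c j w z n := by
  have := sub_nonneg.2 (hmin _ (h.mem (n + 1)))
  unfold mechanicalEnergy
  positivity

/-- The step inequality is used at `x = (1 - τ) w (n + 1) + τ z` with `τ = (α - 1) / (n + 1 + j)`;
for this `τ` both squared distances become the quadratic terms of consecutive energies. -/
theorem energy_succ_le (h : IsInertialDescent D Θ c α j w) (hj : 0 ≤ j) (hα : 1 ≤ α)
    (hz : z ∈ D) {n : ℕ} (hn : α - 1 ≤ n) :
    energy Θ c α j w z (n + 1) + ((α - 3) * (n + 1 + j) + 1) * (Θ (w (n + 1)) - Θ z)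
      ≤ energy Θ c α j w z n := by
  have hM : 0 < (n : ℝ) + 1 + j := by positivity
  set M : ℝ := n + 1 + j with hMdef
  set τ : ℝ := (α - 1) / M with hτ
  have hτM : M * τ = α - 1 := by rw [hτ]; field_simp
  have hαM : M * (α / M) = α := by field_simp
  have hτ0 : 0 ≤ τ := div_nonneg (by linarith) hM.le
  have hτ1 : τ ≤ 1 := (div_le_one hM).2 (by linarith)
  have hx := h.convexOn.2 (h.mem (n + 1)) hz (sub_nonneg.2 hτ1) hτ0 (by ring)
  have hstep := h.step n _ (h.convexOn.1 (h.mem (n + 1)) hz (sub_nonneg.2 hτ1) hτ0 (by ring))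
  rw [← hMdef] at hstep
  have hsq : ∀ v : H, M ^ 2 * ‖v‖ ^ 2 = ‖M • v‖ ^ 2 := fun v => by
    rw [norm_smul, mul_pow, Real.norm_of_nonneg hM.le]
  have e1 : M • (w (n + 2) - ((1 - τ) • w (n + 1) + τ • z))
      = (α - 1) • (w (n + 1) - z) + M • (w (n + 2) - w (n + 1)) := by
    rw [← hτM]; module
  have e2 : M • (w (n + 1) + (1 - α / M) • (w (n + 1) - w n)
      - ((1 - τ) • w (n + 1) + τ • z))
      = (α - 1) • (w n - z) + (M - 1) • (w (n + 1) - w n) := by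
    trans (M * τ) • (w (n + 1) - z) + (M - M * (α / M)) • (w (n + 1) - w n)
    · module
    · rw [hτM, hαM]; module
  have h1 := mul_le_mul_of_nonneg_left hstep (sq_nonneg M)
  rw [mul_add, mul_add, mul_left_comm, mul_left_comm _ c, hsq, hsq, e1, e2] at h1
  have h2 := mul_le_mul_of_nonneg_left hx (sq_nonneg M)
  simp only [smul_eq_mul] at h2
  have h3 : M ^ 2 * ((1 - τ) * Θ (w (n + 1)) + τ * Θ z)
      = (M ^ 2 - (α - 1) * M) * Θ (w (n + 1)) + (α - 1) * M * Θ z := by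
    rw [← hτM]; ring
  rw [h3] at h2
  unfold energy
  push_cast
  rw [show (n : ℝ) + j = M - 1 by rw [hMdef]; ring, ← hMdef]
  linarith

/-- The step inequality at `x = w (n + 1)`, multiplied by `(n + 1 + j) ^ 2`: the damping
`1 - α / (n + 1 + j)` outweighs the growth of the weight on the kinetic term. -/
theorem mechanicalEnergy_succ_le (h : IsInertialDescent D Θ c α j w) (hc : 0 ≤ c) (hj : 0 ≤ j)
    (hα : 2 ≤ α) (hmin : ∀ x ∈ D, Θ z ≤ Θ x) {n : ℕ} (hn : α ≤ n) :
    mechanicalEnergy Θ c j w z (n + 1) + (n + 1 + j) * (c * ‖w (n + 1) - w n‖ ^ 2)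
      ≤ mechanicalEnergy Θ c j w z n + 2 * ((n + 1 + j) * (Θ (w (n + 1)) - Θ z)) := by
  have hM : 0 < (n : ℝ) + 1 + j := by positivity
  have hW := sub_nonneg.2 (hmin _ (h.mem (n + 1)))
  have hstep := h.step n _ (h.mem (n + 1))
  set M : ℝ := n + 1 + j with hMdef
  rw [add_sub_cancel_left, norm_smul, mul_pow, Real.norm_eq_abs, sq_abs] at hstep
  have h1 := mul_le_mul_of_nonneg_left hstep (sq_nonneg M)
  have hd : 0 ≤ c * ‖w (n + 1) - w n‖ ^ 2 := by positivity
  unfold mechanicalEnergy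
  push_cast
  rw [show (n : ℝ) + j = M - 1 by rw [hMdef]; ring, ← hMdef, show n + 1 + 1 = n + 2 from rfl]
  set d := c * ‖w (n + 1) - w n‖ ^ 2
  have h2 : M ^ 2 * (Θ (w (n + 1)) + c * ((1 - α / M) ^ 2 * ‖w (n + 1) - w n‖ ^ 2))
      = M ^ 2 * Θ (w (n + 1)) + (M - α) ^ 2 * d := by
    simp only [d]
    field_simp
  rw [h2] at h1
  -- The difference of squares is `(α - 1) * (2 * M - 1 - α)`.
  have h3 : M * d ≤ ((M - 1) ^ 2 - (M - α) ^ 2) * d := by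
    refine mul_le_mul_of_nonneg_right ?_ hd
    nlinarith
  nlinarith

theorem exists_tendsto_energy (h : IsInertialDescent D Θ c α j w) (hc : 0 ≤ c) (hj : 0 ≤ j)
    (hα : 3 ≤ α) (hz : z ∈ D) (hmin : ∀ x ∈ D, Θ z ≤ Θ x) :
    Summable (fun n : ℕ => ((α - 3) * (n + 1 + j) + 1) * (Θ (w (n + 1)) - Θ z)) ∧
      ∃ l, Tendsto (energy Θ c α j w z) atTop (𝓝 l) := by
  obtain ⟨N, hN⟩ := exists_nat_ge (α - 1)
  refine summable_and_tendsto_of_le_add N (ε := fun _ => 0)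
    (fun n _ => h.energy_nonneg hc hmin n) (fun n _ => ?_) (fun _ _ => le_rfl)
    summable_zero fun n hn => ?_
  · have h1 := sub_nonneg.2 (hmin _ (h.mem (n + 1)))
    have h2 : 0 ≤ α - 3 := by linarith
    positivity
  · have hn' : (N : ℝ) ≤ n := by exact_mod_cast hn
    simpa using h.energy_succ_le hj (by linarith) hz (hN.trans hn')

theorem isBigO (h : IsInertialDescent D Θ c α j w) (hc : 0 ≤ c) (hj : 0 ≤ j)
    (hα : 3 ≤ α) (hz : z ∈ D) (hmin : ∀ x ∈ D, Θ z ≤ Θ x) :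
    (fun n => Θ (w n) - Θ z) =O[atTop] fun n : ℕ => 1 / (n : ℝ) ^ 2 := by
  obtain ⟨-, l, hl⟩ := h.exists_tendsto_energy hc hj hα hz hmin
  obtain ⟨B, hB⟩ := hl.bddAbove_range
  refine IsBigO.of_bound (4 * B) ?_
  filter_upwards [eventually_ge_atTop 2] with k hk
  obtain ⟨n, rfl⟩ : ∃ n, k = n + 1 := ⟨k - 1, by omega⟩
  have hn : (1 : ℝ) ≤ n := by exact_mod_cast (by omega : 1 ≤ n)
  have hW := sub_nonneg.2 (hmin _ (h.mem (n + 1)))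
  have h1 : energy Θ c α j w z n ≤ B := hB ⟨n, rfl⟩
  have h2 : 0 ≤ c * ‖(α - 1) • (w n - z) + (n + j) • (w (n + 1) - w n)‖ ^ 2 := by positivity
  unfold energy at h1
  rw [Real.norm_of_nonneg hW, Real.norm_of_nonneg (by positivity), mul_one_div,
    le_div_iff₀ (by positivity)]
  push_cast
  have h3 : ((n : ℝ) + 1) ^ 2 ≤ 4 * (n + j) ^ 2 := by nlinarith
  have h4 := mul_le_mul_of_nonneg_left h3 hW
  linarith

/-- For `α > 3` the mechanical energy converges and its quotient by `n` is dominated by a summable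
sequence, so its limit is `0`. -/
theorem tendsto_mechanicalEnergy (h : IsInertialDescent D Θ c α j w) (hc : 0 ≤ c) (hj : 0 ≤ j)
    (hα : 3 < α) (hz : z ∈ D) (hmin : ∀ x ∈ D, Θ z ≤ Θ x) :
    Tendsto (mechanicalEnergy Θ c j w z) atTop (𝓝 0) := by
  have hW : ∀ n, 0 ≤ Θ (w (n + 1)) - Θ z := fun n => sub_nonneg.2 (hmin _ (h.mem (n + 1)))
  obtain ⟨hsum, -⟩ := h.exists_tendsto_energy hc hj hα.le hz hmin
  have hα' : 0 < α - 3 := by linarith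
  have hsumW : Summable fun n : ℕ => (n + 1 + j) * (Θ (w (n + 1)) - Θ z) := by
    refine Summable.of_nonneg_of_le (fun n => mul_nonneg (by positivity) (hW n)) (fun n => ?_)
      (hsum.mul_left (α - 3)⁻¹)
    rw [le_inv_mul_iff₀ hα', ← mul_assoc]
    exact mul_le_mul_of_nonneg_right (by linarith) (hW n)
  obtain ⟨N, hN⟩ := exists_nat_ge α
  obtain ⟨hsumd, l, hl⟩ := summable_and_tendsto_of_le_add N
    (E := mechanicalEnergy Θ c j w z)
    (r := fun n : ℕ => (n + 1 + j) * (c * ‖w (n + 1) - w n‖ ^ 2))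
    (ε := fun n : ℕ => 2 * ((n + 1 + j) * (Θ (w (n + 1)) - Θ z)))
    (fun n _ => h.mechanicalEnergy_nonneg hc hmin n) (fun n _ => by positivity)
    (fun n _ => by have := hW n; positivity) (hsumW.mul_left 2) fun n hn => by
      have hn' : (N : ℝ) ≤ n := by exact_mod_cast hn
      exact h.mechanicalEnergy_succ_le hc hj (by linarith) hmin (hN.trans hn')
  have hl0 : l = 0 := by
    refine limit_eq_zero_of_summable hj
      (fun n => h.mechanicalEnergy_nonneg hc hmin n) hl (hsumW.add hsumd)
      (Eventually.of_forall fun n => ?_)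
    have h1 := hW n
    have h2 : 0 ≤ Θ (w (n + 1)) - Θ z + c * ‖w (n + 1) - w n‖ ^ 2 := by positivity
    have h3 : ((n : ℝ) + j) ^ 2 ≤ (n + j) * (n + 1 + j) := by
      have : (0 : ℝ) ≤ n + j := by positivity
      nlinarith
    unfold mechanicalEnergy
    rw [← mul_add, ← mul_assoc]
    exact mul_le_mul_of_nonneg_right h3 h2
  rwa [hl0] at hl

theorem isLittleO (h : IsInertialDescent D Θ c α j w) (hc : 0 ≤ c) (hj : 0 ≤ j)
    (hα : 3 < α) (hz : z ∈ D) (hmin : ∀ x ∈ D, Θ z ≤ Θ x) :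
    (fun n => Θ (w n) - Θ z) =o[atTop] fun n : ℕ => 1 / (n : ℝ) ^ 2 := by
  have hlim := h.tendsto_mechanicalEnergy hc hj hα hz hmin
  rw [isLittleO_iff]
  intro ε hε
  have hev := (tendsto_sub_atTop_nat 1).eventually
    (hlim.eventually (gt_mem_nhds (by positivity : 0 < ε / 4)))
  filter_upwards [hev, eventually_ge_atTop 2] with k h1 hk
  obtain ⟨n, rfl⟩ : ∃ n, k = n + 1 := ⟨k - 1, by omega⟩
  rw [Nat.add_sub_cancel] at h1
  have hn : (1 : ℝ) ≤ n := by exact_mod_cast (by omega : 1 ≤ n)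
  have hW := sub_nonneg.2 (hmin _ (h.mem (n + 1)))
  have h2 : 0 ≤ ((n : ℝ) + j) ^ 2 * (c * ‖w (n + 1) - w n‖ ^ 2) := by positivity
  unfold mechanicalEnergy at h1
  rw [Real.norm_of_nonneg hW, Real.norm_of_nonneg (by positivity), mul_one_div,
    le_div_iff₀ (by positivity)]
  push_cast
  have h3 : ((n : ℝ) + 1) ^ 2 ≤ 4 * (n + j) ^ 2 := by nlinarith
  have h4 := mul_le_mul_of_nonneg_left h3 hW
  linarith

theorem tendsto_mul_norm_sub (h : IsInertialDescent D Θ c α j w) (hc : 0 < c) (hj : 0 ≤ j)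
    (hα : 3 < α) (hz : z ∈ D) (hmin : ∀ x ∈ D, Θ z ≤ Θ x) :
    Tendsto (fun n : ℕ => (n + j) * ‖w (n + 1) - w n‖) atTop (𝓝 0) := by
  have hlim := (h.tendsto_mechanicalEnergy hc.le hj hα hz hmin).const_mul c⁻¹
  rw [mul_zero] at hlim
  have hsq : Tendsto (fun n : ℕ => ((n + j) * ‖w (n + 1) - w n‖) ^ 2) atTop (𝓝 0) := by
    refine squeeze_zero (fun n => sq_nonneg _) (fun n => ?_) hlim
    have hW := sub_nonneg.2 (hmin _ (h.mem (n + 1)))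
    have h1 : 0 ≤ ((n : ℝ) + j) ^ 2 * (Θ (w (n + 1)) - Θ z) := by positivity
    rw [le_inv_mul_iff₀ hc]
    unfold mechanicalEnergy
    linarith
  have h0 := hsq.sqrt
  rw [Real.sqrt_zero] at h0
  exact h0.congr fun n => Real.sqrt_sq (by positivity)

/-- Since `(n + j) • (w (n + 1) - w n)` tends to `0`, the quadratic term of the convergent energy
reduces to `(α - 1) ^ 2 * ‖w n - z‖ ^ 2` in the limit. -/
theorem exists_tendsto_norm_sub (h : IsInertialDescent D Θ c α j w) (hc : 0 < c) (hj : 0 ≤ j)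
    (hα : 3 < α) (hz : z ∈ D) (hmin : ∀ x ∈ D, Θ z ≤ Θ x) :
    ∃ l, Tendsto (fun n => ‖w n - z‖) atTop (𝓝 l) := by
  obtain ⟨-, l, hl⟩ := h.exists_tendsto_energy hc.le hj hα.le hz hmin
  have hW : Tendsto (fun n : ℕ => (n + j) ^ 2 * (Θ (w (n + 1)) - Θ z)) atTop (𝓝 0) := by
    refine squeeze_zero (fun n => ?_) (fun n => ?_)
      (h.tendsto_mechanicalEnergy hc.le hj hα hz hmin)
    · have hW := sub_nonneg.2 (hmin _ (h.mem (n + 1)))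
      positivity
    · have h2 : 0 ≤ ((n : ℝ) + j) ^ 2 * (c * ‖w (n + 1) - w n‖ ^ 2) := by positivity
      unfold mechanicalEnergy
      linarith
  have hnorm : Tendsto (fun n : ℕ => ‖(α - 1) • (w n - z) + (n + j) • (w (n + 1) - w n)‖) atTop
      (𝓝 (Real.sqrt (c⁻¹ * (l - 0)))) := by
    refine ((hl.sub hW).const_mul c⁻¹).sqrt.congr fun n => ?_
    unfold energy
    rw [add_sub_cancel_left, inv_mul_cancel_left₀ hc.ne', Real.sqrt_sq (norm_nonneg _)]
  -- The norm without the velocity term has the same limit.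
  have hdiff : Tendsto (fun n : ℕ => ‖(α - 1) • (w n - z)‖
      - ‖(α - 1) • (w n - z) + (n + j) • (w (n + 1) - w n)‖) atTop (𝓝 0) := by
    refine squeeze_zero_norm (fun n => ?_) (h.tendsto_mul_norm_sub hc hj hα hz hmin)
    refine (abs_norm_sub_norm_le _ _).trans_eq ?_
    rw [sub_add_cancel_left, norm_neg, norm_smul, Real.norm_of_nonneg (by positivity)]
  have hα' : 0 < α - 1 := by linarith
  refine ⟨_, ((hdiff.add hnorm).const_mul (α - 1)⁻¹).congr fun n => ?_⟩
  rw [sub_add_cancel, norm_smul, Real.norm_of_nonneg hα'.le, inv_mul_cancel_left₀ hα'.ne']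

theorem tendsto_norm_succ_sub (h : IsInertialDescent D Θ c α j w) (hc : 0 < c) (hj : 0 ≤ j)
    (hα : 3 < α) (hz : z ∈ D) (hmin : ∀ x ∈ D, Θ z ≤ Θ x) :
    Tendsto (fun n => ‖w (n + 1) - w n‖) atTop (𝓝 0) := by
  refine squeeze_zero' (Eventually.of_forall fun n => norm_nonneg _) ?_
    (h.tendsto_mul_norm_sub hc hj hα hz hmin)
  filter_upwards [eventually_ge_atTop 1] with n hn
  have hn' : (1 : ℝ) ≤ n := by exact_mod_cast hn
  exact le_mul_of_one_le_left (norm_nonneg _) (by linarith)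

/-- Opial's lemma applies: distances to minimizers converge, and weak cluster points are minimizers
because the sublevel sets of `Θ` are closed and convex. -/
theorem exists_weakLim [CompleteSpace H] (h : IsInertialDescent D Θ c α j w) (hc : 0 < c)
    (hj : 0 ≤ j) (hα : 3 < α) (hcl : ∀ r, IsClosed {x | x ∈ D ∧ Θ x ≤ r})
    (hz : z ∈ D) (hmin : ∀ x ∈ D, Θ z ≤ Θ x) :
    ∃ z' ∈ D, (∀ x ∈ D, Θ z' ≤ Θ x) ∧ WeakLim w z' := by
  have hΘ : Tendsto (fun n => Θ (w n)) atTop (𝓝 (Θ z)) := by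
    have h1 : Tendsto (fun n : ℕ => 1 / (n : ℝ) ^ 2) atTop (𝓝 0) := by
      simp only [one_div]
      exact ((tendsto_pow_atTop two_ne_zero).comp
        (tendsto_natCast_atTop_atTop (R := ℝ))).inv_tendsto_atTop
    simpa using ((h.isBigO hc.le hj hα.le hz hmin).trans_tendsto h1).add_const (Θ z)
  obtain ⟨z', ⟨h1, h2⟩, h3⟩ := opial (u := w) (S := {x | x ∈ D ∧ ∀ x' ∈ D, Θ x ≤ Θ x'})
    ⟨z, hz, hmin⟩ (fun x hx => h.exists_tendsto_norm_sub hc hj hα hx.1 hx.2) fun U hU x hx => by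
      have key : ∀ ε > 0, x ∈ D ∧ Θ x ≤ Θ z + ε := fun ε hε => by
        refine mem_of_weak_limit (h.convexOn.convex_le _) (hcl _) (l := U) ?_ hx
        have := (hΘ.eventually (gt_mem_nhds (lt_add_of_pos_right (Θ z) hε))).filter_mono hU
        exact this.mono fun n hn => ⟨h.mem n, hn.le⟩
      exact ⟨(key 1 one_pos).1, fun x' hx' =>
        (le_of_forall_pos_le_add fun ε hε => (key ε hε).2).trans (hmin x' hx')⟩
  exact ⟨z', h1, h2, h3⟩

end IsInertialDescent

end Lyapunov

/-! ### Extended-real-valued functions -/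

section EffectiveDomain
variable {X : Type*} {f : X → ℝ} {g : X → EReal}

/-- The effective domain of an extended-real-valued function. -/
def dom (g : X → EReal) : Set X := {x | g x ≠ ⊤}

theorem Proper.eq_coe (hg : Proper g) {x : X} (hx : x ∈ dom g) : g x = ((g x).toReal : EReal) :=
  (EReal.coe_toReal hx (hg.1 x)).symm

theorem Proper.theta_eq_coe (hg : Proper g) {x : X} (hx : x ∈ dom g) :
    theta f g x = ((f x + (g x).toReal : ℝ) : EReal) := by
  rw [theta, hg.eq_coe hx, EReal.toReal_coe, EReal.coe_add]

theorem theta_eq_top {x : X} (hx : x ∉ dom g) : theta f g x = ⊤ := by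
  have hx' : g x = ⊤ := not_not.1 hx
  rw [theta, hx', EReal.coe_add_top]

theorem Proper.mem_argmin_theta_iff (hg : Proper g) {z : X} :
    z ∈ argmin (theta f g) ↔
      z ∈ dom g ∧ ∀ x ∈ dom g, f z + (g z).toReal ≤ f x + (g x).toReal := by
  constructor
  · intro hz
    obtain ⟨x₀, hx₀⟩ := hg.2
    have hzd : z ∈ dom g := by
      by_contra hcon
      have h := hz x₀
      rw [theta_eq_top hcon, hg.theta_eq_coe hx₀, top_le_iff] at h
      exact EReal.coe_ne_top _ h
    refine ⟨hzd, fun x hx => ?_⟩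
    have h := hz x
    rw [hg.theta_eq_coe hzd, hg.theta_eq_coe hx] at h
    exact EReal.coe_le_coe_iff.1 h
  · rintro ⟨hz, hmin⟩ x
    by_cases hx : x ∈ dom g
    · rw [hg.theta_eq_coe hz, hg.theta_eq_coe hx]
      exact EReal.coe_le_coe_iff.2 (hmin x hx)
    · rw [theta_eq_top hx]
      exact le_top

theorem toReal_iInf_theta (hg : Proper g) {z : X} (hz : z ∈ argmin (theta f g)) :
    (⨅ x, theta f g x).toReal = f z + (g z).toReal := by
  have : ⨅ x, theta f g x = theta f g z := le_antisymm (iInf_le _ z) (le_iInf hz)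
  rw [this, hg.theta_eq_coe (hg.mem_argmin_theta_iff.1 hz).1, EReal.toReal_coe]

theorem Proper.isClosed_sublevel [TopologicalSpace X] (hg : Proper g) (hl : LowerSemicontinuous g)
    (c : ℝ) : IsClosed {x | x ∈ dom g ∧ (g x).toReal ≤ c} := by
  have : {x | x ∈ dom g ∧ (g x).toReal ≤ c} = g ⁻¹' Set.Iic (c : EReal) := by
    ext x
    constructor
    · rintro ⟨hx, h⟩
      rw [Set.mem_preimage, hg.eq_coe hx]
      exact EReal.coe_le_coe_iff.2 h
    · intro h
      have hx : x ∈ dom g := (lt_of_le_of_lt h (EReal.coe_lt_top c)).ne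
      rw [Set.mem_preimage, hg.eq_coe hx] at h
      exact ⟨hx, EReal.coe_le_coe_iff.1 h⟩
  rw [this]
  exact hl.isClosed_preimage c

end EffectiveDomain

section ProxEReal
variable {g : H → EReal}

theorem EConvex.convexOn_toReal (hc : EConvex g) (hg : Proper g) :
    ConvexOn ℝ (dom g) fun x => (g x).toReal := by
  have key : ∀ x ∈ dom g, ∀ x' ∈ dom g, ∀ a b : ℝ, 0 ≤ a → 0 ≤ b → a + b = 1 →
      g (a • x + b • x') ≤ ((a * (g x).toReal + b * (g x').toReal : ℝ) : EReal) := by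
    intro x hx x' hx' a b ha hb hab
    have h := hc x x' a b ha hb hab
    rw [hg.eq_coe hx, hg.eq_coe hx'] at h
    exact_mod_cast h
  have hmem : ∀ x ∈ dom g, ∀ x' ∈ dom g, ∀ a b : ℝ, 0 ≤ a → 0 ≤ b → a + b = 1 →
      a • x + b • x' ∈ dom g := fun x hx x' hx' a b ha hb hab =>
    ((key x hx x' hx' a b ha hb hab).trans_lt (EReal.coe_lt_top _)).ne
  refine ⟨fun x hx x' hx' a b ha hb hab => hmem x hx x' hx' a b ha hb hab,
    fun x hx x' hx' a b ha hb hab => ?_⟩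
  have h := key x hx x' hx' a b ha hb hab
  rw [hg.eq_coe (hmem x hx x' hx' a b ha hb hab)] at h
  exact EReal.coe_le_coe_iff.1 h

theorem mem_argmin_prox_iff {E : Type*} [NormedAddCommGroup E] {g : E → EReal} (hg : Proper g)
    {s : ℝ} (hs : 0 < s) {v p : E} :
    p ∈ argmin (fun x => (s : EReal) * g x + ((‖x - v‖ ^ 2 / 2 : ℝ) : EReal)) ↔
      p ∈ dom g ∧ ∀ x ∈ dom g, s * (g p).toReal + ‖p - v‖ ^ 2 / 2
        ≤ s * (g x).toReal + ‖x - v‖ ^ 2 / 2 := by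
  have hcoe : ∀ x ∈ dom g, (s : EReal) * g x + ((‖x - v‖ ^ 2 / 2 : ℝ) : EReal)
      = ((s * (g x).toReal + ‖x - v‖ ^ 2 / 2 : ℝ) : EReal) := fun x hx => by
    rw [hg.eq_coe hx, EReal.toReal_coe]
    norm_cast
  have htop : ∀ x, x ∉ dom g → (s : EReal) * g x + ((‖x - v‖ ^ 2 / 2 : ℝ) : EReal) = ⊤ :=
    fun x hx => by
      have hx' : g x = ⊤ := not_not.1 hx
      rw [hx', EReal.coe_mul_top_of_pos hs, EReal.top_add_coe]
  constructor
  · intro hp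
    obtain ⟨x₀, hx₀⟩ := hg.2
    have hpd : p ∈ dom g := by
      by_contra hcon
      have h := hp x₀
      simp only [htop p hcon, hcoe x₀ hx₀, top_le_iff] at h
      exact EReal.coe_ne_top _ h
    refine ⟨hpd, fun x hx => ?_⟩
    have h := hp x
    simp only [hcoe p hpd, hcoe x hx] at h
    exact EReal.coe_le_coe_iff.1 h
  · rintro ⟨hp, hmin⟩ x
    by_cases hx : x ∈ dom g
    · simp only [hcoe p hp, hcoe x hx]
      exact EReal.coe_le_coe_iff.2 (hmin x hx)
    · simp only [htop x hx]
      exact le_top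

/-- `prox` of `s * g` is a true minimizer as soon as `g` has a continuous affine minorant. -/
theorem prox_spec [CompleteSpace H] (hg : Proper g) (hc : EConvex g) (hl : LowerSemicontinuous g)
    {a : H} {b : ℝ} (hminor : ∀ x ∈ dom g, b + inner ℝ a x ≤ (g x).toReal) {s : ℝ} (hs : 0 < s)
    (v : H) : prox (fun x => (s : EReal) * g x) v ∈ dom g ∧ ∀ x ∈ dom g,
      s * (g (prox (fun x => (s : EReal) * g x) v)).toReal
        + ‖prox (fun x => (s : EReal) * g x) v - v‖ ^ 2 / 2
        ≤ s * (g x).toReal + ‖x - v‖ ^ 2 / 2 := by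
  have hcl : ∀ r, IsClosed {x | x ∈ dom g ∧ s * (g x).toReal ≤ r} := fun r => by
    simp_rw [← le_div_iff₀' hs]
    exact hg.isClosed_sublevel hl _
  obtain ⟨p, hp, hmin⟩ := exists_prox (G := fun x => s * (g x).toReal)
    ((hc.convexOn_toReal hg).smul hs.le) hcl hg.2 (a := s • a) (b := s * b) (fun x hx => by
      rw [real_inner_smul_left, ← mul_add]
      exact mul_le_mul_of_nonneg_left (hminor x hx) hs.le) v
  exact (mem_argmin_prox_iff hg hs).1
    (Classical.epsilon_spec (p := fun q => q ∈ argmin fun x =>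
      (s : EReal) * g x + ((‖x - v‖ ^ 2 / 2 : ℝ) : EReal))
      ⟨p, (mem_argmin_prox_iff hg hs).2 ⟨hp, hmin⟩⟩)

end ProxEReal

end RAPG

theorem theorem6p1 {H : Type*} [NormedAddCommGroup H] [InnerProductSpace ℝ H] [CompleteSpace H]
    (f : H → ℝ) (g : H → EReal) (L : ℝ≥0) (s α : ℝ) (j : ℕ) (y w : ℕ → H)
    (hf_smooth : ContDiff ℝ 1 f)
    (hf_convex : ConvexOn ℝ Set.univ f)
    (hf_lip : LipschitzWith L (gradient f))
    (hg_proper : RAPG.Proper g)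
    (hg_convex : RAPG.EConvex g)
    (hg_lsc : LowerSemicontinuous g)
    (hS : (RAPG.argmin (RAPG.theta f g)).Nonempty)
    (hα : 3 ≤ α)
    (hsL : s * (L : ℝ) ∈ Set.Ioc (0 : ℝ) 1)
    (hj : j = 0 ∨ j = 1)
    (hyw : RAPG.IsRAPG f g s α j y w) :
    (∀ k, RAPG.theta f g (w k) ≠ ⊤) ∧
    ((fun k : ℕ => (RAPG.theta f g (w k)).toReal - (⨅ x, RAPG.theta f g x).toReal)
      =O[atTop] fun k : ℕ => 1 / (k : ℝ) ^ 2) ∧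
    (3 < α →
      ((fun k : ℕ => (RAPG.theta f g (w k)).toReal - (⨅ x, RAPG.theta f g x).toReal)
        =o[atTop] fun k : ℕ => 1 / (k : ℝ) ^ 2) ∧
      ∃ z ∈ RAPG.argmin (RAPG.theta f g), RAPG.WeakLim y z ∧ RAPG.WeakLim w z) := by
  have hs : 0 < s := pos_of_mul_pos_left hsL.1 L.coe_nonneg
  have hgrad : ∀ x, HasGradientAt f (gradient f x) x := fun x =>
    ((hf_smooth.differentiable one_ne_zero) x).hasGradientAt
  have hG := hg_convex.convexOn_toReal hg_proper
  obtain ⟨z, hzS⟩ := hS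
  obtain ⟨hz, hmin⟩ := hg_proper.mem_argmin_theta_iff.1 hzS
  -- The existence of a minimizer of `θ` gives `g` its affine minorant.
  have hminor : ∀ x ∈ RAPG.dom g, ((g z).toReal - inner ℝ (-gradient f z) z)
      + inner ℝ (-gradient f z) x ≤ (g x).toReal := fun x hx => by
    have h := RAPG.add_inner_neg_gradient_le_of_minimizer hgrad hf_lip hG hz hmin hx
    rw [inner_sub_right] at h
    linarith
  have hprox := fun n => RAPG.prox_spec hg_proper hg_convex hg_lsc hminor hs
    (y n - s • gradient f (y n))
  have hw_eq : ∀ n, w n = RAPG.prox (fun x => (s : EReal) * g x) (y n - s • gradient f (y n)) :=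
    fun n => by
      rw [hyw.w_eq n, RAPG.T, smul_smul, mul_one_div_cancel hs.ne', one_smul, sub_sub_cancel]
  simp_rw [← hw_eq] at hprox
  have hdesc : RAPG.IsInertialDescent (RAPG.dom g) (fun x => f x + (g x).toReal) (1 / (2 * s)) α j
      w := by
    refine ⟨(hf_convex.subset (Set.subset_univ _) hG.1).add hG, fun n => (hprox n).1,
      fun n x hx => ?_⟩
    have h := RAPG.proximal_gradient_inequality hgrad hf_lip hf_convex hs hsL.2 hG
      (hprox (n + 2)).1 (hprox (n + 2)).2 hx
    have hy := hyw.y_succ (n + 1) (by omega)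
    rw [Nat.add_sub_cancel] at hy
    push_cast at hy
    rwa [hy] at h
  have hc : 0 < 1 / (2 * s) := by positivity
  have hj0 : (0 : ℝ) ≤ j := j.cast_nonneg
  have hval : ∀ k, (RAPG.theta f g (w k)).toReal - (⨅ x, RAPG.theta f g x).toReal
      = f (w k) + (g (w k)).toReal - (f z + (g z).toReal) := fun k => by
    rw [RAPG.toReal_iInf_theta hg_proper hzS, hg_proper.theta_eq_coe (hdesc.mem k),
      EReal.toReal_coe]
  simp_rw [hval]
  refine ⟨fun k => ?_, hdesc.isBigO hc.le hj0 hα hz hmin, fun hα3 =>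
    ⟨hdesc.isLittleO hc.le hj0 hα3 hz hmin, ?_⟩⟩
  · rw [hg_proper.theta_eq_coe (hdesc.mem k)]
    exact EReal.coe_ne_top _
  · have hcl : ∀ r, IsClosed {x | x ∈ RAPG.dom g ∧ f x + (g x).toReal ≤ r} := fun r => by
      simp_rw [add_comm (f _)]
      exact RAPG.isClosed_sublevel_add (fun c => hg_proper.isClosed_sublevel hg_lsc c)
        hf_smooth.continuous r
    obtain ⟨z', hz', hmin', hwz⟩ := hdesc.exists_weakLim hc hj0 hα3 hcl hz hmin
    refine ⟨z', hg_proper.mem_argmin_theta_iff.2 ⟨hz', hmin'⟩, ?_, hwz⟩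
    -- `y n - w n` is a combination of two consecutive increments of `w` with bounded coefficients.
    have hstep := hdesc.tendsto_norm_succ_sub hc hj0 hα3 hz hmin
    refine hwz.of_norm_sub_tendsto ((tendsto_add_atTop_iff_nat 2).1 ?_)
    have hbound := (hstep.const_mul (1 + α)).add ((tendsto_add_atTop_iff_nat 1).2 hstep)
    rw [mul_zero, zero_add] at hbound
    refine squeeze_zero (fun n => norm_nonneg _) (fun n => ?_) hbound
    have hy := hyw.y_succ (n + 1) (by omega)
    rw [Nat.add_sub_cancel] at hy
    push_cast at hy
    have hcoef : ‖1 - α / ((n : ℝ) + 1 + j)‖ ≤ 1 + α := by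
      have h1 : 0 ≤ α / ((n : ℝ) + 1 + j) := by positivity
      have h2 : α / ((n : ℝ) + 1 + j) ≤ α :=
        div_le_self (by linarith) (by linarith [n.cast_nonneg (α := ℝ)])
      rw [Real.norm_eq_abs, abs_le]
      constructor <;> linarith
    calc ‖y (n + 2) - w (n + 2)‖
        = ‖(1 - α / ((n : ℝ) + 1 + j)) • (w (n + 1) - w n) - (w (n + 2) - w (n + 1))‖ := by
          rw [show n + 2 = n + 1 + 1 from rfl, hy]
          congr 1
          abel
      _ ≤ ‖(1 - α / ((n : ℝ) + 1 + j)) • (w (n + 1) - w n)‖ + ‖w (n + 2) - w (n + 1)‖ :=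
          norm_sub_le _ _
      _ ≤ (1 + α) * ‖w (n + 1) - w n‖ + ‖w (n + 2) - w (n + 1)‖ := by
          rw [norm_smul]
          gcongr
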